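/- Let $N>1$ be a real number and let $(M,d,\mathsf m)$ be a metric measure space: $(M,d)$ is a complete, separable, geodesic metric space and $\mathsf m$ is a locally finite Borel measure on $M$ with $\operatorname{supp}\mathsf m=M$. Let $P_2(M,d,\mathsf m)$ be the set of $\mathsf m$-absolutely continuous Borel probability measures on $M$ with finite second moment, equipped with the $L^2$-Wasserstein distance $W_2$, and for $\mu=\rho\,\mathsf m\in P_2(M,d,\mathsf m)$ put $\mathrm{Ent}_{N'}(\mu|\mathsf m)=-\int_M\rho^{1-1/N'}\,d\mathsf m\in[-\infty,0]$. Assume that $(M,d,\mathsf m)$ satisfies the condition $\mathsf{CD}(0,N)$: for all $N'\ge N$ and all $\mu_0,\mu_1\in P_2(M,d,\mathsf m)$ there is a constant-speed minimizing $W_2$-geodesic $\Gamma:[0,1]\to P_2(M,d,\mathsf m)$ from $\mu_0$ to $\mu_1$ such that $$\mathrm{Ent}_{N'}(\Gamma(s)|\mathsf m)\le(1-s)\,\mathrm{Ent}_{N'}(\mu_0|\mathsf m)+s\,\mathrm{Ent}_{N'}(\mu_1|\mathsf m)\qquad\text{for all } s\in[0,1]$$ (with the convention $0\cdot(-\infty)=0$).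 Let $B_x(r)=\{y\in M:d(x,y)<r\}$ and $\omega_N=\pi^{N/2}/\Gamma(1+N/2)$, put $$\mathsf{AVR}=\sup_{x\in M}\limsup_{r\to\infty}\frac{\mathsf m(B_x(r))}{\omega_Nr^N}\in[0,\infty],$$ and assume Euclidean volume growth, i.e. $\mathsf{AVR}>0$. For $\Omega\subset M$ let $$\mathsf m^+(\Omega)=\liminf_{\varepsilon\to0^+}\frac{\mathsf m(\Omega_\varepsilon\setminus\Omega)}{\varepsilon},\qquad \Omega_\varepsilon=\{x\in M:\exists\,y\in\Omega,\ d(x,y)<\varepsilon\}.$$ Then the following hold. 1. The asymptotic volume ratio is well defined: $\mathsf{AVR}<\infty$, and $\lim_{r\to\infty}\mathsf m(B_x(r))/(\omega_Nr^N)=\mathsf{AVR}$ for every $x\in M$. 2. For every bounded Borel set $\Omega\subset M$, $$\mathsf m^+(\Omega)\ \ge\ N\,\omega_N^{1/N}\,\mathsf{AVR}^{1/N}\,\mathsf m(\Omega)^{(N-1)/N}.$$ 3. This inequality is sharp: for every $C>N\omega_N^{1/N}\mathsf{AVR}^{1/N}$ there is a bounded Borel set $\Omega\subset M$ with $\mathsf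 m(\Omega)>0$ and $\mathsf m^+(\Omega)<C\,\mathsf m(\Omega)^{(N-1)/N}$. Moreover, for every $x_0\in M$, $$\lim_{r\to\infty}\frac{\mathsf m^+(B_{x_0}(r))}{\mathsf m(B_{x_0}(r))^{(N-1)/N}}=N\,\omega_N^{1/N}\,\mathsf{AVR}^{1/N}.$$ -/

import Mathlib

open MeasureTheory Filter
open scoped ENNReal Topology

namespace MMS

noncomputable section

/-- A metric space is geodesic: any two points `x`, `y` are joined by a minimizing geodesic
`γ : [0,1] → M` parametrized proportionally to arclength. -/
def IsGeodesicSpace (M : Type*) [MetricSpace M] : Prop :=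
  ∀ x y : M, ∃ γ : ℝ → M, γ 0 = x ∧ γ 1 = y ∧
    ∀ s ∈ Set.Icc (0 : ℝ) 1, ∀ t ∈ Set.Icc (0 : ℝ) 1,
      dist (γ s) (γ t) = |s - t| * dist x y

/-- `μ ∈ P₂(M,d)`: a Borel probability measure with finite second moment. -/
structure IsP2 {M : Type*} [MetricSpace M] [MeasurableSpace M] (μ : Measure M) : Prop where
  isProbability : IsProbabilityMeasure μ
  finite_moment : ∃ x₀ : M, ∫⁻ x, edist x₀ x ^ 2 ∂μ < ∞

/-- `μ ∈ P₂(M,d,m)`: moreover `μ` is absolutely continuous with respect to `m`. -/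
structure IsP2AC {M : Type*} [MetricSpace M] [MeasurableSpace M] (m μ : Measure M) : Prop
    extends IsP2 μ where
  absolutelyContinuous : μ ≪ m

/-- `π` is a coupling (transport plan) of `μ` and `ν`. -/
def IsCoupling {M : Type*} [MeasurableSpace M] (μ ν : Measure M) (π : Measure (M × M)) : Prop :=
  π.map Prod.fst = μ ∧ π.map Prod.snd = ν

/-- The `L²`-Wasserstein distance
`W₂(μ,ν) = (inf { ∫ d(x,y)² dπ(x,y) : π a coupling of μ and ν })^{1/2}`. -/
def W2 {M : Type*} [MetricSpace M] [MeasurableSpace M] (μ ν : Measure M) : ℝ≥0∞ :=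
  (⨅ π : {π : Measure (M × M) // IsCoupling μ ν π},
    ∫⁻ p, edist p.1 p.2 ^ 2 ∂π.1) ^ (1 / 2 : ℝ)

/-- `Γ : [0,1] → P₂(M,d,m)` is a (minimizing, constant speed) `W₂`-geodesic from `μ₀` to `μ₁`. -/
structure IsP2ACGeodesic {M : Type*} [MetricSpace M] [MeasurableSpace M] (m : Measure M)
    (μ₀ μ₁ : Measure M) (Γ : ℝ → Measure M) : Prop where
  mem : ∀ s ∈ Set.Icc (0 : ℝ) 1, IsP2AC m (Γ s)
  source : Γ 0 = μ₀
  target : Γ 1 = μ₁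
  speed : ∀ s ∈ Set.Icc (0 : ℝ) 1, ∀ t ∈ Set.Icc (0 : ℝ) 1,
    W2 (Γ s) (Γ t) = ENNReal.ofReal |s - t| * W2 μ₀ μ₁

/-- The Rényi entropy `Ent_N(μ|m) = - ∫ ρ^{1-1/N} dm`, where `ρ` is the density of the absolutely
continuous part of `μ`. The integral of the nonnegative function `ρ^{1-1/N}` may be infinite,
and then the entropy is `-∞`. -/
def renyiEntropy {M : Type*} [MeasurableSpace M] (N : ℝ) (m μ : Measure M) : EReal :=
  -((∫⁻ x, μ.rnDeriv m x ^ (1 - 1 / N) ∂m : ℝ≥0∞) : EReal)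

/-- The curvature-dimension condition `CD(0,N)`: for every `N' ≥ N`, the functional
`Ent_{N'}(·|m)` is (weakly) convex along geodesics of `P₂(M,d,m)`. -/
def CD0 {M : Type*} [MetricSpace M] [MeasurableSpace M] (N : ℝ) (m : Measure M) : Prop :=
  ∀ N' : ℝ, N ≤ N' → ∀ μ₀ μ₁ : Measure M, IsP2AC m μ₀ → IsP2AC m μ₁ →
    ∃ Γ : ℝ → Measure M, IsP2ACGeodesic m μ₀ μ₁ Γ ∧
      ∀ s ∈ Set.Icc (0 : ℝ) 1,
        renyiEntropy N' m (Γ s) ≤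
          ((1 - s : ℝ) : EReal) * renyiEntropy N' m μ₀ + (s : EReal) * renyiEntropy N' m μ₁

/-- `ω_N = π^{N/2} / Γ(1 + N/2)`. -/
def omega (N : ℝ) : ℝ := Real.pi ^ (N / 2) / Real.Gamma (1 + N / 2)

/-- The volume ratio `m(B_x(r)) / (ω_N r^N)`. -/
def volumeRatio {M : Type*} [MetricSpace M] [MeasurableSpace M] (N : ℝ) (m : Measure M)
    (x : M) (r : ℝ) : ℝ≥0∞ :=
  m (Metric.ball x r) / ENNReal.ofReal (omega N * r ^ N)

/-- The asymptotic volume ratio. For an arbitrary measure the limit of the volume ratios as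
`r → ∞` need not exist and could depend on the centre, so the definition takes the supremum over
the centres of the upper limits; whenever the limit exists and does not depend on the centre,
this is that limit. -/
def avr {M : Type*} [MetricSpace M] [MeasurableSpace M] (N : ℝ) (m : Measure M) : ℝ≥0∞ :=
  ⨆ x : M, limsup (fun r : ℝ => volumeRatio N m x r) atTop

/-- The Minkowski content `m⁺(Ω) = liminf_{ε → 0⁺} m(Ω_ε \ Ω) / ε`, where `Ω_ε` is the open
`ε`-neighbourhood of `Ω`. -/
def minkowskiContent {M : Type*} [MetricSpace M] [MeasurableSpace M] (m : Measure M)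
    (Ω : Set M) : ℝ≥0∞ :=
  liminf (fun ε : ℝ => m (Metric.thickening ε Ω \ Ω) / ENNReal.ofReal ε) (𝓝[>] 0)

/-- The constant `N ω_N^{1/N} AVR^{1/N}`. -/
def isopConstant {M : Type*} [MetricSpace M] [MeasurableSpace M] (N : ℝ) (m : Measure M) : ℝ≥0∞ :=
  ENNReal.ofReal (N * omega N ^ (1 / N)) * avr N m ^ (1 / N)

end

end MMS

namespace MMS

/-! Everything follows from a Brunn–Minkowski inequality. If all distances between `A` and `B` are
at most `D` and `s * D < L`, then the `L`-thickening of `A` has measure to the power `1/N` at least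
`(1-s) m(A)^{1/N} + s m(B)^{1/N}`. To see this, apply `CD0` to the normalized restrictions of `m` to
`A` and `B`: their entropies are `-m(A)^{1/N}` and `-m(B)^{1/N}`, the intermediate measure is
carried by the thickening, and Hölder bounds its entropy below. Gluing nearly optimal couplings
locates that measure, so neither optimal plans nor geodesics in `M` are needed
(`IsP2ACGeodesic.measure_compl_thickening`, `CD0.brunn_minkowski`).

With a small and a large concentric ball this gives Bishop–Gromov, hence a limit `l` of
`m(B_x(r))^{1/N} / r`, independent of `x`; then `AVR = l^N / ω_N` and the isoperimetric constant is
`N * l`. With `A = Ω`, `B` a ball of radius `R` and `s` of order `ε / R`, letting `ε → 0` and then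
`R → ∞` gives the isoperimetric inequality. Conversely, Bishop–Gromov bounds `m⁺` of a ball by `N
m(B_x(r)) / r`, so the isoperimetric quotient of large balls tends to `N * l`. -/

/-- Gluing of two couplings along their common marginal. -/
theorem exists_glued_measure {X Y Z : Type*} [MeasurableSpace X] [MeasurableSpace Y]
    [MeasurableSpace Z] [StandardBorelSpace Z] [Nonempty Z]
    (π₁ : Measure (X × Y)) (π₂ : Measure (Y × Z)) [IsFiniteMeasure π₁] [IsFiniteMeasure π₂]
    (h : π₁.map Prod.snd = π₂.map Prod.fst) :
    ∃ γ : Measure ((X × Y) × Z), γ.map Prod.fst = π₁ ∧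
      γ.map (fun p => (p.1.2, p.2)) = π₂ := by
  -- Given `(x, y)`, the third coordinate is drawn from the conditional law of `π₂` given `y`.
  refine ⟨π₁.compProd (π₂.condKernel.comap Prod.snd measurable_snd), ?_, ?_⟩
  · exact Measure.fst_compProd _ _
  · ext s hs
    have hm : Measurable (fun p : (X × Y) × Z => (p.1.2, p.2)) := by fun_prop
    rw [Measure.map_apply hm hs, Measure.compProd_apply (hm hs)]
    conv_rhs => rw [← π₂.disintegrate π₂.condKernel]
    rw [Measure.compProd_apply hs, Measure.fst, ← h,
      lintegral_map (ProbabilityTheory.Kernel.measurable_kernel_prodMk_left hs) measurable_snd]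
    rfl

/-! ### Wasserstein geodesics and the location of intermediate measures. -/

section Metric

theorem IsCoupling.isProbabilityMeasure {M : Type*} [MeasurableSpace M] {μ ν : Measure M} [IsProbabilityMeasure μ]
    {π : Measure (M × M)} (h : IsCoupling μ ν π) : IsProbabilityMeasure π := by
  constructor
  have := congrArg (fun κ : Measure M => κ Set.univ) h.1
  simpa [Measure.map_apply measurable_fst MeasurableSet.univ] using this

theorem isCoupling_prod {M : Type*} [MeasurableSpace M] (μ ν : Measure M) [IsProbabilityMeasure μ] [IsProbabilityMeasure ν] :
    IsCoupling μ ν (μ.prod ν) := by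
  constructor
  · simp [Measure.map_fst_prod]
  · simp [Measure.map_snd_prod]

variable {M : Type*} [MetricSpace M] [MeasurableSpace M]

theorem W2_sq (μ ν : Measure M) : W2 μ ν ^ 2 =
    ⨅ π : {π : Measure (M × M) // IsCoupling μ ν π}, ∫⁻ p, edist p.1 p.2 ^ 2 ∂π.1 := by
  rw [W2, ← ENNReal.rpow_natCast, ← ENNReal.rpow_mul]
  norm_num

theorem W2_sq_le {μ ν : Measure M} {π : Measure (M × M)} (h : IsCoupling μ ν π) :
    W2 μ ν ^ 2 ≤ ∫⁻ p, edist p.1 p.2 ^ 2 ∂π := by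
  rw [W2_sq]
  exact iInf_le (fun π : {π : Measure (M × M) // IsCoupling μ ν π} =>
    ∫⁻ p, edist p.1 p.2 ^ 2 ∂π.1) ⟨π, h⟩

theorem exists_coupling_lt {μ ν : Measure M} {c : ℝ≥0∞} (h : W2 μ ν ^ 2 < c) :
    ∃ π : Measure (M × M), IsCoupling μ ν π ∧ ∫⁻ p, edist p.1 p.2 ^ 2 ∂π < c := by
  rw [W2_sq, iInf_lt_iff] at h
  obtain ⟨π, hπ⟩ := h
  exact ⟨π.1, π.2, hπ⟩

/-- Two probability measures carried by sets at finite mutual distance are at finite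
`W₂`-distance. -/
theorem W2_sq_ne_top {μ ν : Measure M} [IsProbabilityMeasure μ] [IsProbabilityMeasure ν]
    {A B : Set M} {D : ℝ} (hA : ∀ᵐ x ∂μ, x ∈ A) (hB : ∀ᵐ x ∂ν, x ∈ B)
    (hD : ∀ x ∈ A, ∀ z ∈ B, dist x z ≤ D) : W2 μ ν ^ 2 ≠ ∞ := by
  have hc := isCoupling_prod μ ν
  refine ne_top_of_le_ne_top (b := ENNReal.ofReal D ^ 2) (by finiteness) ((W2_sq_le hc).trans ?_)
  have h1 : ∀ᵐ p ∂(μ.prod ν), p.1 ∈ A := Measure.quasiMeasurePreserving_fst.ae hA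
  have h2 : ∀ᵐ p ∂(μ.prod ν), p.2 ∈ B := Measure.quasiMeasurePreserving_snd.ae hB
  calc ∫⁻ p, edist p.1 p.2 ^ 2 ∂(μ.prod ν) ≤ ∫⁻ _, ENNReal.ofReal D ^ 2 ∂(μ.prod ν) := by
        refine lintegral_mono_ae ?_
        filter_upwards [h1, h2] with p hp1 hp2
        gcongr
        rw [edist_dist]
        exact ENNReal.ofReal_le_ofReal (hD _ hp1 _ hp2)
    _ = ENNReal.ofReal D ^ 2 := by simp

/-- Strict convexity of the square: if `x, y, z` satisfy the triangle inequality and `y` is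
farther from `x` than an `s`-intermediate point, then the weighted energy exceeds `d(x,z)²`. -/
theorem sq_add_le_weighted_sq {s a b d η : ℝ} (hs : 0 < s) (hs1 : s < 1)
    (hd : 0 ≤ d) (htri : d ≤ a + b) (hη : 0 ≤ η) (ha : s * (d + η) ≤ a) :
    d ^ 2 + s * η ^ 2 ≤ s⁻¹ * a ^ 2 + (1 - s)⁻¹ * b ^ 2 := by
  have h1 : 0 < 1 - s := by linarith
  -- In these variables the energy is `s p² + (1-s) q²`, an average of squares. Expanding around `d`
  -- leaves a nonnegative linear term by `htri`, plus `s (p-d)² + (1-s) (q-d)²`.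
  obtain ⟨p, rfl⟩ : ∃ p, a = s * p := ⟨a / s, by field_simp⟩
  obtain ⟨q, rfl⟩ : ∃ q, b = (1 - s) * q := ⟨b / (1 - s), by field_simp⟩
  have e1 : s⁻¹ * (s * p) ^ 2 = s * p ^ 2 := by field_simp
  have e2 : (1 - s)⁻¹ * ((1 - s) * q) ^ 2 = (1 - s) * q ^ 2 := by field_simp
  rw [e1, e2]
  have hp : d + η ≤ p := le_of_mul_le_mul_left ha hs
  have h2 : η ^ 2 ≤ (p - d) ^ 2 := pow_le_pow_left₀ hη (by linarith) 2
  have h3 : 0 ≤ d * (s * p + (1 - s) * q - d) := mul_nonneg hd (by linarith)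
  nlinarith [mul_le_mul_of_nonneg_left h2 hs.le, mul_nonneg h1.le (sq_nonneg (q - d))]

/-- Cauchy–Schwarz, with the defect from `(a + b)²` an explicit square. It serves the triples whose
middle point stays in the thickening. -/
theorem sq_le_weighted_sq {s a b d : ℝ} (hs : 0 < s) (hs1 : s < 1)
    (hd : 0 ≤ d) (htri : d ≤ a + b) :
    d ^ 2 ≤ s⁻¹ * a ^ 2 + (1 - s)⁻¹ * b ^ 2 := by
  have h1 : 0 < 1 - s := by linarith
  have h := pow_le_pow_left₀ hd htri 2
  refine h.trans ?_
  rw [← sub_nonneg]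
  have : s⁻¹ * a ^ 2 + (1 - s)⁻¹ * b ^ 2 - (a + b) ^ 2 =
      (s * (1 - s))⁻¹ * ((1 - s) * a - s * b) ^ 2 := by
    field_simp
    ring
  rw [this]
  positivity

variable [BorelSpace M]

/-- The intermediate measures of a `W₂`-geodesic between measures carried by `A` and `B` are
carried by the neighbourhoods of `A` that contain the intermediate points of all geodesics
from `A` to `B`. -/
theorem IsP2ACGeodesic.measure_compl_thickening [CompleteSpace M]
    [TopologicalSpace.SeparableSpace M] {m μ₀ μ₁ : Measure M} {Γ : ℝ → Measure M}
    (hΓ : IsP2ACGeodesic m μ₀ μ₁ Γ) {A B : Set M} {D L s : ℝ}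
    (hA : ∀ᵐ x ∂μ₀, x ∈ A) (hB : ∀ᵐ x ∂μ₁, x ∈ B)
    (hD : ∀ x ∈ A, ∀ z ∈ B, dist x z ≤ D) (hs : 0 < s) (hs1 : s < 1) (hL : s * D < L) :
    Γ s (Metric.thickening L A)ᶜ = 0 := by
  have : SecondCountableTopology M := UniformSpace.secondCountable_of_separable M
  have : PolishSpace M := inferInstance
  have hs' : s ∈ Set.Icc (0 : ℝ) 1 := ⟨hs.le, hs1.le⟩
  have h0 : (0 : ℝ) ∈ Set.Icc (0 : ℝ) 1 := by simp
  have h1 : (1 : ℝ) ∈ Set.Icc (0 : ℝ) 1 := by simp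
  have P0 : IsProbabilityMeasure μ₀ := hΓ.source ▸ (hΓ.mem 0 h0).isProbability
  have P1 : IsProbabilityMeasure μ₁ := hΓ.target ▸ (hΓ.mem 1 h1).isProbability
  have Ps : IsProbabilityMeasure (Γ s) := (hΓ.mem s hs').isProbability
  have : Nonempty M := by
    obtain ⟨x, -⟩ := hA.exists
    exact ⟨x⟩
  have h1s : 0 < 1 - s := by linarith
  have hW := W2_sq_ne_top hA hB hD
  have hs0 := hΓ.speed 0 h0 s hs'
  have hs2 := hΓ.speed s hs' 1 h1
  rw [hΓ.source, show |0 - s| = s by rw [zero_sub, abs_neg, abs_of_pos hs]] at hs0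
  rw [hΓ.target, show |s - 1| = 1 - s by rw [abs_sub_comm, abs_of_pos h1s]] at hs2
  set W := W2 μ₀ μ₁ with hWdef
  set T := Metric.thickening L A with hT
  have hTm : MeasurableSet T := Metric.isOpen_thickening.measurableSet
  -- Chosen so that `s * (D + η) = L`: a middle point outside the thickening is farther than an
  -- `s`-intermediate point by at least `s * η`.
  set η : ℝ := L / s - D with hη
  have hη0 : 0 < η := by
    rw [hη, sub_pos, lt_div_iff₀ hs]; linarith
  -- Glue couplings of cost below `s² (W² + ε)` and `(1-s)² (W² + ε)`. With weights `1/s` and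
  -- `1/(1-s)` their total is at most `W² + ε`, while the outer marginals alone cost at least `W²`.
  -- The mass outside the thickening pays an extra `s η²` per unit, so that penalty is at most `ε`.
  have key : ∀ ε : NNReal, 0 < ε → (0 : ℝ≥0∞) < ∞ →
      ENNReal.ofReal (s * η ^ 2) * Γ s Tᶜ ≤ 0 + ε := by
    intro ε hε _
    have hWε : W ^ 2 < W ^ 2 + ε := ENNReal.lt_add_right hW (by simpa using hε.ne')
    have scaled : ∀ (t : ℝ), 0 < t → (ENNReal.ofReal t * W) ^ 2 <
        ENNReal.ofReal t ^ 2 * (W ^ 2 + ε) := by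
      intro t ht
      rw [mul_pow]
      exact (ENNReal.mul_lt_mul_iff_right (by positivity) (by finiteness)).2 hWε
    obtain ⟨π₁, hc1, hl1⟩ := exists_coupling_lt (hs0 ▸ scaled s hs)
    obtain ⟨π₂, hc2, hl2⟩ := exists_coupling_lt (hs2 ▸ scaled (1 - s) h1s)
    have := hc1.isProbabilityMeasure
    have := hc2.isProbabilityMeasure
    obtain ⟨γ, hγ1, hγ2⟩ := exists_glued_measure π₁ π₂ (hc1.2.trans hc2.1.symm)
    have mx : γ.map (fun p => p.1.1) = μ₀ := by
      rw [← hc1.1, ← hγ1, Measure.map_map measurable_fst measurable_fst]; rfl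
    have my : γ.map (fun p => p.1.2) = Γ s := by
      rw [← hc1.2, ← hγ1, Measure.map_map measurable_snd measurable_fst]; rfl
    have mz : γ.map (fun p => p.2) = μ₁ := by
      rw [← hc2.2, ← hγ2, Measure.map_map measurable_snd (by fun_prop)]; rfl
    have hcoup : IsCoupling μ₀ μ₁ (γ.map (fun p => (p.1.1, p.2))) := by
      constructor
      · rw [Measure.map_map measurable_fst (by fun_prop), ← mx]; rfl
      · rw [Measure.map_map measurable_snd (by fun_prop), ← mz]; rfl
    have hlow : W ^ 2 ≤ ∫⁻ p, edist p.1.1 p.2 ^ 2 ∂γ := by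
      refine (W2_sq_le hcoup).trans_eq ?_
      rw [lintegral_map (by fun_prop) (by fun_prop)]
    have hup1 : ∫⁻ p, ENNReal.ofReal s⁻¹ * edist p.1.1 p.1.2 ^ 2 ∂γ ≤
        ENNReal.ofReal s * (W ^ 2 + ε) := by
      rw [lintegral_const_mul _ (by fun_prop)]
      have : ∫⁻ p, edist p.1.1 p.1.2 ^ 2 ∂γ = ∫⁻ p, edist p.1 p.2 ^ 2 ∂π₁ := by
        rw [← hγ1, lintegral_map (by fun_prop) (by fun_prop)]
      rw [this]
      refine (mul_le_mul_right hl1.le _).trans_eq ?_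
      rw [← mul_assoc, ← ENNReal.ofReal_pow hs.le, ← ENNReal.ofReal_mul (by positivity)]
      congr 2; field_simp
    have hup2 : ∫⁻ p, ENNReal.ofReal (1 - s)⁻¹ * edist p.1.2 p.2 ^ 2 ∂γ ≤
        ENNReal.ofReal (1 - s) * (W ^ 2 + ε) := by
      rw [lintegral_const_mul _ (by fun_prop)]
      have : ∫⁻ p, edist p.1.2 p.2 ^ 2 ∂γ = ∫⁻ p, edist p.1 p.2 ^ 2 ∂π₂ := by
        rw [← hγ2, lintegral_map (by fun_prop) (by fun_prop)]
      rw [this]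
      refine (mul_le_mul_right hl2.le _).trans_eq ?_
      rw [← mul_assoc, ← ENNReal.ofReal_pow h1s.le, ← ENNReal.ofReal_mul (by positivity)]
      congr 2; field_simp
    have hAγ : ∀ᵐ p ∂γ, p.1.1 ∈ A := by
      rw [← mx] at hA
      exact ae_of_ae_map (by fun_prop) hA
    have hBγ : ∀ᵐ p ∂γ, p.2 ∈ B := by
      rw [← mz] at hB
      exact ae_of_ae_map (by fun_prop) hB
    have hpt : ∀ᵐ p ∂γ, edist p.1.1 p.2 ^ 2 +
        ((fun p : (M × M) × M => p.1.2) ⁻¹' Tᶜ).indicator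
          (fun _ => ENNReal.ofReal (s * η ^ 2)) p ≤
        ENNReal.ofReal s⁻¹ * edist p.1.1 p.1.2 ^ 2 +
          ENNReal.ofReal (1 - s)⁻¹ * edist p.1.2 p.2 ^ 2 := by
      filter_upwards [hAγ, hBγ] with p hpA hpB
      simp only [edist_dist, ← ENNReal.ofReal_pow dist_nonneg]
      rw [← ENNReal.ofReal_mul (by positivity), ← ENNReal.ofReal_mul (by positivity),
        ← ENNReal.ofReal_add (by positivity) (by positivity)]
      have htri := dist_triangle p.1.1 p.1.2 p.2
      by_cases hp : p ∈ (fun p : (M × M) × M => p.1.2) ⁻¹' Tᶜ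
      · rw [Set.indicator_of_mem hp, ← ENNReal.ofReal_add (by positivity) (by positivity)]
        refine ENNReal.ofReal_le_ofReal
          (sq_add_le_weighted_sq hs hs1 dist_nonneg htri hη0.le ?_)
        have hfar : L ≤ dist p.1.1 p.1.2 := by
          by_contra! hlt
          exact hp (Metric.mem_thickening_iff.2 ⟨p.1.1, hpA, by rwa [dist_comm]⟩)
        calc s * (dist p.1.1 p.2 + η) ≤ s * (D + η) := by gcongr; exact hD _ hpA _ hpB
          _ = L := by rw [hη]; field_simp; ring
          _ ≤ _ := hfar
      · rw [Set.indicator_of_notMem hp, add_zero]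
        exact ENNReal.ofReal_le_ofReal (sq_le_weighted_sq hs hs1 dist_nonneg htri)
    have hEm : MeasurableSet ((fun p : (M × M) × M => p.1.2) ⁻¹' Tᶜ) :=
      (by fun_prop : Measurable (fun p : (M × M) × M => p.1.2)) hTm.compl
    have hint := lintegral_mono_ae hpt
    rw [lintegral_add_left (by fun_prop), lintegral_add_left (by fun_prop),
      lintegral_indicator_const hEm,
      ← Measure.map_apply (by fun_prop) hTm.compl, my] at hint
    have hfin : W ^ 2 + ENNReal.ofReal (s * η ^ 2) * Γ s Tᶜ ≤ W ^ 2 + ε := by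
      calc _ ≤ _ := add_le_add_left hlow _
        _ ≤ _ := hint
        _ ≤ _ := add_le_add hup1 hup2
        _ = W ^ 2 + ε := by
          rw [← add_mul, ← ENNReal.ofReal_add hs.le h1s.le]; simp
    rw [zero_add]
    -- Cancelling `W²` needs its finiteness, which comes from the bound `D`.
    exact (ENNReal.add_le_add_iff_left hW).1 hfin
  have hz := ENNReal.le_of_forall_pos_le_add key
  have hne : ENNReal.ofReal (s * η ^ 2) ≠ 0 := by
    rw [Ne, ENNReal.ofReal_eq_zero, not_le]; positivity
  exact (mul_eq_zero.1 (le_antisymm hz zero_le)).resolve_left hne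

end Metric

/-! ### Rényi entropy of measures carried by a set. -/

section Entropy

variable {M : Type*} [MeasurableSpace M]

/-- Hölder's inequality for the integrand of the Rényi entropy of a density carried by `T`. -/
theorem lintegral_rpow_le_measure_rpow {N : ℝ} (hN : 1 < N) (m : Measure M) {f : M → ℝ≥0∞}
    (hf : Measurable f) {T : Set M} (hT : MeasurableSet T) (h0 : ∀ᵐ x ∂m, x ∉ T → f x = 0) :
    ∫⁻ x, f x ^ (1 - 1 / N) ∂m ≤ m T ^ (1 / N) * (∫⁻ x, f x ∂m) ^ (1 - 1 / N) := by
  have hN0 : 0 < N := by linarith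
  have hexp : 0 < 1 - 1 / N := by
    rw [sub_pos, div_lt_one hN0]; exact hN
  have hconj : N.HolderConjugate (1 - 1 / N)⁻¹ :=
    Real.holderConjugate_iff.2 ⟨hN, by simp⟩
  have hH := ENNReal.lintegral_mul_le_Lp_mul_Lq m hconj
    (f := T.indicator 1) (g := fun x => f x ^ (1 - 1 / N))
    ((measurable_one.indicator hT).aemeasurable) (hf.pow_const _).aemeasurable
  have e1 : ∫⁻ x, T.indicator (1 : M → ℝ≥0∞) x ^ N ∂m = m T := by
    rw [← lintegral_indicator_one hT]
    refine lintegral_congr fun x => ?_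
    by_cases hx : x ∈ T <;> simp [hx, hN0]
  have e2 : ∀ x, (f x ^ (1 - 1 / N)) ^ (1 - 1 / N)⁻¹ = f x := fun x => by
    rw [← ENNReal.rpow_mul, mul_inv_cancel₀ hexp.ne', ENNReal.rpow_one]
  simp only [e1, e2] at hH
  rw [one_div (1 - 1 / N)⁻¹, inv_inv] at hH
  refine le_trans (lintegral_mono_ae ?_) hH
  filter_upwards [h0] with x hx
  by_cases hxT : x ∈ T
  · simp [hxT]
  · rw [hx hxT, ENNReal.zero_rpow_of_pos hexp]
    exact zero_le

/-- Among probability measures carried by a set the uniform one minimizes the entropy; this is the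
bound used at the intermediate measure. Only total density at most `1` enters. -/
theorem lintegral_rnDeriv_rpow_le {N : ℝ} (hN : 1 < N) (m μ : Measure M) [IsProbabilityMeasure μ]
    {T : Set M} (hT : MeasurableSet T) (hμ : μ Tᶜ = 0) :
    ∫⁻ x, μ.rnDeriv m x ^ (1 - 1 / N) ∂m ≤ m T ^ (1 / N) := by
  have hexp : 0 ≤ 1 - 1 / N := by
    rw [sub_nonneg, div_le_one (by linarith)]; exact hN.le
  have hz : ∫⁻ x in Tᶜ, μ.rnDeriv m x ∂m = 0 :=
    le_antisymm ((Measure.setLIntegral_rnDeriv_le _).trans_eq hμ) zero_le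
  rw [setLIntegral_eq_zero_iff hT.compl (Measure.measurable_rnDeriv μ m)] at hz
  refine (lintegral_rpow_le_measure_rpow hN m (Measure.measurable_rnDeriv μ m) hT hz).trans ?_
  have h1 : ∫⁻ x, μ.rnDeriv m x ∂m ≤ 1 := Measure.lintegral_rnDeriv_le.trans_eq measure_univ
  calc _ ≤ m T ^ (1 / N) * 1 ^ (1 - 1 / N) := by gcongr
    _ = _ := by simp

/-- The entropy of a normalized restriction. -/
theorem lintegral_rnDeriv_cond_rpow {N : ℝ} (hN : 1 < N) (m : Measure M) [SigmaFinite m]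
    {A : Set M} (hA : MeasurableSet A) (h0 : m A ≠ 0) (htop : m A ≠ ∞) :
    ∫⁻ x, (ProbabilityTheory.cond m A).rnDeriv m x ^ (1 - 1 / N) ∂m = m A ^ (1 / N) := by
  have hexp : 0 < 1 - 1 / N := by
    rw [sub_pos, div_lt_one (by linarith)]; exact hN
  have : IsFiniteMeasure (m.restrict A) := ⟨by simpa using htop.lt_top⟩
  -- The density is `1 / m(A)` on `A` and zero elsewhere; the positive exponent keeps the zero.
  have hae : (fun x => (ProbabilityTheory.cond m A).rnDeriv m x ^ (1 - 1 / N)) =ᵐ[m]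
      A.indicator fun _ => (m A)⁻¹ ^ (1 - 1 / N) := by
    filter_upwards [Measure.rnDeriv_smul_left_of_ne_top (m.restrict A) m
      (ENNReal.inv_ne_top.2 h0), Measure.rnDeriv_restrict_self m hA] with x h1 h2
    rw [ProbabilityTheory.cond, h1, Pi.smul_apply, h2]
    by_cases hx : x ∈ A
    · simp [hx]
    · simp only [Set.indicator_of_notMem hx, smul_zero, ENNReal.zero_rpow_of_pos hexp]
  rw [lintegral_congr_ae hae, lintegral_indicator_const hA, ENNReal.inv_rpow, ← ENNReal.rpow_neg]
  conv_lhs => rw [← ENNReal.rpow_one (m A), ← ENNReal.rpow_mul]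
  rw [← ENNReal.rpow_add _ _ h0 htop]
  congr 1; ring

end Entropy

/-- Neither summand can be `⊤`, so the `EReal` sum is never indeterminate and the convexity
inequality becomes one in `ℝ≥0∞`, infinite integrals included. -/
theorem convex_comb_neg_coe_ennreal {s : ℝ} (hs : 0 ≤ s) (hs1 : s ≤ 1) (a b : ℝ≥0∞) :
    ((1 - s : ℝ) : EReal) * -(a : EReal) + (s : EReal) * -(b : EReal) =
      -((ENNReal.ofReal (1 - s) * a + ENNReal.ofReal s * b : ℝ≥0∞) : EReal) := by
  have key : ∀ t : ℝ, 0 ≤ t → ∀ c : ℝ≥0∞,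
      (t : EReal) * -(c : EReal) = -((ENNReal.ofReal t * c : ℝ≥0∞) : EReal) := fun t ht c => by
    rw [EReal.coe_ennreal_mul, EReal.coe_ennreal_ofReal, max_eq_left ht, mul_neg]
  rw [key _ (by linarith), key _ hs, EReal.coe_ennreal_add,
    EReal.neg_add (Or.inl (EReal.coe_ennreal_ne_bot _)) (Or.inr (EReal.coe_ennreal_ne_bot _))]
  rfl

/-! ### Brunn–Minkowski, finiteness of balls, Bishop–Gromov. -/

section BrunnMinkowski

variable {M : Type*} [MetricSpace M] [MeasurableSpace M]

theorem isP2AC_cond {m : Measure M} {A : Set M} (hA : MeasurableSet A)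
    (hb : Bornology.IsBounded A) (h0 : m A ≠ 0) (htop : m A ≠ ∞) :
    IsP2AC m (ProbabilityTheory.cond m A) := by
  have hp := ProbabilityTheory.cond_isProbabilityMeasure_of_finite h0 htop
  obtain ⟨x₀, hx₀⟩ := nonempty_of_measure_ne_zero h0
  refine ⟨⟨hp, x₀, ?_⟩, ProbabilityTheory.cond_absolutelyContinuous⟩
  calc ∫⁻ x, edist x₀ x ^ 2 ∂(ProbabilityTheory.cond m A)
      ≤ ∫⁻ _, Metric.ediam A ^ 2 ∂(ProbabilityTheory.cond m A) := by
        refine lintegral_mono_ae ?_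
        filter_upwards [ProbabilityTheory.ae_cond_mem hA] with x hx
        gcongr
        exact Metric.edist_le_ediam_of_mem hx₀ hx
    _ = Metric.ediam A ^ 2 := by simp
    _ < ∞ := ENNReal.pow_lt_top (Metric.isBounded_iff_ediam_ne_top.1 hb).lt_top

variable [BorelSpace M] [CompleteSpace M] [TopologicalSpace.SeparableSpace M]

/-- The Brunn–Minkowski inequality in `CD(0,N)` spaces. -/
theorem CD0.brunn_minkowski {m : Measure M} [IsLocallyFiniteMeasure m] {N : ℝ} (hN : 1 < N)
    (hCD : CD0 N m) {A B : Set M} (hA : MeasurableSet A) (hB : MeasurableSet B)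
    (hAb : Bornology.IsBounded A) (hBb : Bornology.IsBounded B)
    (hA0 : m A ≠ 0) (hAtop : m A ≠ ∞) (hB0 : m B ≠ 0) (hBtop : m B ≠ ∞) {D L s : ℝ}
    (hD : ∀ x ∈ A, ∀ z ∈ B, dist x z ≤ D) (hs : 0 < s) (hs1 : s < 1) (hL : s * D < L) :
    ENNReal.ofReal (1 - s) * m A ^ (1 / N) + ENNReal.ofReal s * m B ^ (1 / N) ≤
      m (Metric.thickening L A) ^ (1 / N) := by
  have : SecondCountableTopology M := UniformSpace.secondCountable_of_separable M
  have hs' : s ∈ Set.Icc (0 : ℝ) 1 := ⟨hs.le, hs1.le⟩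
  obtain ⟨Γ, hΓ, hent⟩ := hCD N le_rfl _ _ (isP2AC_cond hA hAb hA0 hAtop)
    (isP2AC_cond hB hBb hB0 hBtop)
  have hsupp := hΓ.measure_compl_thickening (ProbabilityTheory.ae_cond_mem hA)
    (ProbabilityTheory.ae_cond_mem hB) hD hs hs1 hL
  have hp := (hΓ.mem s hs').isProbability
  have h := hent s hs'
  rw [renyiEntropy, renyiEntropy, renyiEntropy, lintegral_rnDeriv_cond_rpow hN m hA hA0 hAtop,
    lintegral_rnDeriv_cond_rpow hN m hB hB0 hBtop, convex_comb_neg_coe_ennreal hs.le hs1.le,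
    EReal.neg_le_neg_iff, EReal.coe_ennreal_le_coe_ennreal_iff] at h
  exact h.trans (lintegral_rnDeriv_rpow_le hN m _ Metric.isOpen_thickening.measurableSet hsupp)

/-- Local finiteness gives one finite ball around `x`. Brunn–Minkowski from a smaller ball, with `s`
so small that the thickening stays in the finite one, bounds uniformly the measure of every
finite-measure subset of the large ball. -/
theorem CD0.measure_ball_lt_top {m : Measure M} [IsLocallyFiniteMeasure m]
    [m.IsOpenPosMeasure] {N : ℝ} (hN : 1 < N) (hCD : CD0 N m) (x : M) (R : ℝ) :
    m (Metric.ball x R) < ∞ := by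
  have : SecondCountableTopology M := UniformSpace.secondCountable_of_separable M
  have hN0 : 0 < N := by linarith
  obtain ⟨U, hU, hUfin⟩ := m.finiteAt_nhds x
  obtain ⟨δ, hδ, hδU⟩ := Metric.mem_nhds_iff.1 hU
  have hδfin : m (Metric.ball x δ) < ∞ := (measure_mono hδU).trans_lt hUfin
  rcases le_or_gt R δ with hR | hR
  · exact (measure_mono (Metric.ball_subset_ball hR)).trans_lt hδfin
  set D := R + δ / 2 with hDdef
  have hDpos : 0 < D := by linarith
  set s := δ / 4 / D with hs
  have hs0 : 0 < s := by positivity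
  have hs1 : s < 1 := by rw [hs, div_lt_one hDpos]; linarith
  have hsD : s * D < δ / 2 := by rw [hs, div_mul_cancel₀ _ hDpos.ne']; linarith
  set c := m (Metric.ball x δ) ^ (1 / N) / ENNReal.ofReal s with hc
  have hcfin : c < ∞ :=
    ENNReal.div_lt_top (by finiteness) (by simpa using hs0)
  by_contra! htop
  have hlt : c ^ N < m (Metric.ball x R) :=
    (ENNReal.rpow_lt_top_of_nonneg hN0.le hcfin.ne).trans_le htop
  -- The ball itself, of infinite measure, cannot be normalized; a finite-measure subset already
  -- exceeding the bound can.
  obtain ⟨B, hBm, hBsub, hBlt, hBfin⟩ :=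
    Measure.exists_subset_measure_lt_top Metric.isOpen_ball.measurableSet hlt
  have hsm : Metric.ball x (δ / 2) ⊆ Metric.ball x δ := Metric.ball_subset_ball (by linarith)
  have hBM := hCD.brunn_minkowski hN (A := Metric.ball x (δ / 2)) (B := B) (D := D) (L := δ / 2)
    Metric.isOpen_ball.measurableSet hBm Metric.isBounded_ball (Metric.isBounded_ball.subset hBsub)
    (Metric.measure_ball_pos m x (by linarith)).ne' ((measure_mono hsm).trans_lt hδfin).ne
    (zero_le.trans_lt hBlt).ne' hBfin.ne
    (fun y hy z hz => by
      have h1 := Metric.mem_ball.1 hy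
      have h2 := Metric.mem_ball'.1 (hBsub hz)
      linarith [dist_triangle y x z]) hs0 hs1 hsD
  have hsub : Metric.thickening (δ / 2) (Metric.ball x (δ / 2)) ⊆ Metric.ball x δ := by
    simpa using Metric.thickening_ball x (δ / 2) (δ / 2)
  have h3 : ENNReal.ofReal s * m B ^ (1 / N) ≤ m (Metric.ball x δ) ^ (1 / N) :=
    le_add_self.trans (hBM.trans (by gcongr))
  have h4 : m B ^ (1 / N) ≤ c := by
    rw [hc, ENNReal.le_div_iff_mul_le (Or.inl (by simpa using hs0)) (Or.inl (by simp)), mul_comm]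
    exact h3
  have h5 : m B ≤ c ^ N := by
    rwa [one_div, ENNReal.rpow_inv_le_iff hN0] at h4
  exact hBlt.not_ge h5

theorem CD0.measure_lt_top_of_isBounded {m : Measure M} [IsLocallyFiniteMeasure m]
    [m.IsOpenPosMeasure] {N : ℝ} (hN : 1 < N) (hCD : CD0 N m) {A : Set M}
    (hA : Bornology.IsBounded A) : m A < ∞ := by
  rcases A.eq_empty_or_nonempty with rfl | ⟨x, -⟩
  · simp
  · obtain ⟨R, hR⟩ := hA.subset_ball x
    exact (measure_mono hR).trans_lt (hCD.measure_ball_lt_top hN x R)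

/-- The Brunn–Minkowski inequality for real-valued measures. -/
theorem CD0.brunn_minkowski_real {m : Measure M} [IsLocallyFiniteMeasure m]
    [m.IsOpenPosMeasure] {N : ℝ} (hN : 1 < N)
    (hCD : CD0 N m) {A B : Set M} (hA : MeasurableSet A) (hB : MeasurableSet B)
    (hAb : Bornology.IsBounded A) (hBb : Bornology.IsBounded B)
    (hA0 : m A ≠ 0) (hB0 : m B ≠ 0) {D L s : ℝ}
    (hD : ∀ x ∈ A, ∀ z ∈ B, dist x z ≤ D) (hs : 0 < s) (hs1 : s < 1) (hL : s * D < L) :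
    (1 - s) * m.real A ^ (1 / N) + s * m.real B ^ (1 / N) ≤
      m.real (Metric.thickening L A) ^ (1 / N) := by
  have hA' := (hCD.measure_lt_top_of_isBounded hN hAb).ne
  have hB' := (hCD.measure_lt_top_of_isBounded hN hBb).ne
  have hT' := (hCD.measure_lt_top_of_isBounded hN (hAb.thickening (δ := L))).ne
  have hinv : 0 ≤ 1 / N := by
    have : 0 < N := by linarith
    positivity
  have h := hCD.brunn_minkowski hN hA hB hAb hBb hA0 hA' hB0 hB' hD hs hs1 hL
  have h' := ENNReal.toReal_mono (by finiteness) h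
  rw [ENNReal.toReal_add (by finiteness) (by finiteness), ENNReal.toReal_mul, ENNReal.toReal_mul,
    ENNReal.toReal_ofReal (by linarith), ENNReal.toReal_ofReal hs.le, ← ENNReal.toReal_rpow,
    ← ENNReal.toReal_rpow, ← ENNReal.toReal_rpow] at h'
  exact h'

theorem CD0.measureReal_ball_pos {m : Measure M} [IsLocallyFiniteMeasure m]
    [m.IsOpenPosMeasure] {N : ℝ} (hN : 1 < N) (hCD : CD0 N m) (x : M) {r : ℝ} (hr : 0 < r) :
    0 < m.real (Metric.ball x r) :=
  ENNReal.toReal_pos (Metric.measure_ball_pos m x hr).ne' (hCD.measure_ball_lt_top hN x r).ne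

/-- The Bishop–Gromov inequality: `r ↦ m(B_x(r))^{1/N} / r` is nonincreasing. -/
theorem CD0.bishop_gromov {m : Measure M} [IsLocallyFiniteMeasure m]
    [m.IsOpenPosMeasure] {N : ℝ} (hN : 1 < N) (hCD : CD0 N m) (x : M) {r R : ℝ}
    (hr : 0 < r) (hR : r ≤ R) :
    m.real (Metric.ball x R) ^ (1 / N) / R ≤ m.real (Metric.ball x r) ^ (1 / N) / r := by
  rcases hR.eq_or_lt with rfl | hlt
  · rfl
  have hR0 : 0 < R := hr.trans hlt
  suffices h : r / R * m.real (Metric.ball x R) ^ (1 / N) ≤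
      m.real (Metric.ball x r) ^ (1 / N) by
    rw [le_div_iff₀ hr]
    calc _ = r / R * m.real (Metric.ball x R) ^ (1 / N) := by ring
      _ ≤ _ := h
  -- Brunn–Minkowski requires `s * D < L` strictly, so the critical `s = r / R` is reached only as a
  -- limit from below.
  have htend : Tendsto (fun s : ℝ => s * m.real (Metric.ball x R) ^ (1 / N)) (𝓝[<] (r / R))
      (𝓝 (r / R * m.real (Metric.ball x R) ^ (1 / N))) :=
    (tendsto_id.mul_const _).mono_left nhdsWithin_le_nhds
  refine le_of_tendsto htend ?_
  filter_upwards [Ioo_mem_nhdsLT (div_pos hr hR0)] with s hs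
  have hs1 : s < 1 := hs.2.trans ((div_lt_one hR0).2 hlt)
  have hsR : s * R < r := (lt_div_iff₀ hR0).1 hs.2
  -- Then `r - δ = s * R + 2 * δ`, which exceeds `s * (R + δ)` because `s < 1`.
  set δ := (r - s * R) / 3 with hδ
  have hδ0 : 0 < δ := by rw [hδ]; linarith
  have hBM := hCD.brunn_minkowski_real hN (A := Metric.ball x δ) (B := Metric.ball x R)
    (D := R + δ) (L := r - δ)
    Metric.isOpen_ball.measurableSet Metric.isOpen_ball.measurableSet Metric.isBounded_ball
    Metric.isBounded_ball (Metric.measure_ball_pos m x hδ0).ne'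
    (Metric.measure_ball_pos m x hR0).ne'
    (fun y hy z hz => by
      have h1 := Metric.mem_ball.1 hy
      have h2 := Metric.mem_ball'.1 hz
      linarith [dist_triangle y x z]) hs.1 hs1 (by nlinarith [mul_lt_mul_of_pos_right hs1 hδ0])
  have hsub : Metric.thickening (r - δ) (Metric.ball x δ) ⊆ Metric.ball x r := by
    simpa using Metric.thickening_ball x (r - δ) δ
  have hnn : 0 ≤ (1 - s) * m.real (Metric.ball x δ) ^ (1 / N) :=
    mul_nonneg (by linarith) (by positivity)
  refine (le_add_of_nonneg_left hnn).trans (hBM.trans ?_)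
  have : 0 ≤ 1 / N := by
    have : 0 < N := by linarith
    positivity
  exact Real.rpow_le_rpow measureReal_nonneg
    (measureReal_mono hsub (hCD.measure_ball_lt_top hN x r).ne) this

end BrunnMinkowski

theorem omega_pos {N : ℝ} (hN : 0 < N) : 0 < omega N :=
  div_pos (Real.rpow_pos_of_pos Real.pi_pos _) (Real.Gamma_pos_of_pos (by positivity))

/-- The linear lower bound for `t ↦ ((1 - t) a + t b)^N` at `t = 0`. -/
theorem rpow_add_le_convex_comb_rpow {N a b s : ℝ} (hN : 1 ≤ N) (ha : 0 < a) (hb : 0 ≤ b)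
    (hs : 0 ≤ s) (hs1 : s ≤ 1) :
    a ^ N + N * a ^ (N - 1) * (s * (b - a)) ≤ ((1 - s) * a + s * b) ^ N := by
  have hsb : 0 ≤ s * b := mul_nonneg hs hb
  have hge : -1 ≤ s * (b - a) / a := by
    rw [le_div_iff₀ ha]
    nlinarith
  -- Bernoulli's inequality, after pulling out `a ^ N`.
  have h := one_add_mul_self_le_rpow_one_add hge hN
  have e1 : (1 - s) * a + s * b = a * (1 + s * (b - a) / a) := by field_simp; ring
  rw [e1, Real.mul_rpow ha.le (by linarith), Real.rpow_sub_one ha.ne']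
  calc _ = a ^ N * (1 + N * (s * (b - a) / a)) := by field_simp
    _ ≤ _ := by gcongr

/-! ### Asymptotic volume ratio, isoperimetric inequality and sharpness. -/

section Isoperimetric

variable {M : Type*} [MetricSpace M] [MeasurableSpace M]

theorem avr_eq_of_forall_tendsto {m : Measure M} {N : ℝ} [Nonempty M] {a : ℝ≥0∞}
    (h : ∀ x : M, Tendsto (fun r => volumeRatio N m x r) atTop (𝓝 a)) : avr N m = a := by
  simp [avr, (h _).limsup_eq]

theorem isopConstant_eq {m : Measure M} {N : ℝ} (hN : 1 < N) {l : ℝ} (hl : 0 ≤ l)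
    (h : avr N m = ENNReal.ofReal (l ^ N / omega N)) :
    isopConstant N m = ENNReal.ofReal (N * l) := by
  have hN0 : 0 < N := by linarith
  have hω := omega_pos hN0
  rw [isopConstant, h, ENNReal.ofReal_rpow_of_nonneg (by positivity) (by positivity),
    ← ENNReal.ofReal_mul (by positivity), Real.div_rpow (by positivity) hω.le, one_div,
    Real.rpow_rpow_inv hl hN0.ne']
  congr 1
  field_simp

variable [BorelSpace M] [CompleteSpace M] [TopologicalSpace.SeparableSpace M]
  {m : Measure M} [IsLocallyFiniteMeasure m] [m.IsOpenPosMeasure] {N : ℝ}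

theorem CD0.exists_tendsto_ball_rpow_div (hN : 1 < N) (hCD : CD0 N m) (x : M) :
    ∃ l : ℝ, Tendsto (fun r => m.real (Metric.ball x r) ^ (1 / N) / r) atTop (𝓝 l) := by
  -- Bishop–Gromov covers positive radii only; replacing `r` by `max r 1` gives a function antitone
  -- on all of `ℝ` with the same behaviour at infinity.
  have hanti : Antitone fun r : ℝ =>
      m.real (Metric.ball x (max r 1)) ^ (1 / N) / max r 1 := fun r R h =>
    hCD.bishop_gromov hN x (by positivity) (max_le_max_right 1 h)
  have hbdd : BddBelow (Set.range fun r : ℝ =>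
      m.real (Metric.ball x (max r 1)) ^ (1 / N) / max r 1) :=
    ⟨0, by rintro _ ⟨r, rfl⟩; positivity⟩
  refine ⟨_, (tendsto_atTop_ciInf hanti hbdd).congr' ?_⟩
  filter_upwards [eventually_ge_atTop 1] with r hr
  simp [max_eq_left hr]

/-- The ball around `y` lies in the ball around `x` of radius `r + dist x y`, and `(r + dist x y) /
r → 1`. Used in both directions, this makes the limit independent of the centre. -/
theorem CD0.ball_rpow_div_limit_le (hN : 1 < N) (hCD : CD0 N m) {x y : M} {l l' : ℝ}
    (hx : Tendsto (fun r => m.real (Metric.ball x r) ^ (1 / N) / r) atTop (𝓝 l))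
    (hy : Tendsto (fun r => m.real (Metric.ball y r) ^ (1 / N) / r) atTop (𝓝 l')) :
    l' ≤ l := by
  have h1 : Tendsto (fun r : ℝ => r + dist x y) atTop atTop :=
    tendsto_atTop_add_const_right _ _ tendsto_id
  have h2 : Tendsto (fun r : ℝ => 1 + dist x y / r) atTop (𝓝 (1 + 0)) :=
    tendsto_const_nhds.add (tendsto_const_nhds.div_atTop tendsto_id)
  have h3 := (hx.comp h1).mul h2
  rw [add_zero, mul_one] at h3
  refine le_of_tendsto_of_tendsto hy h3 ?_
  filter_upwards [eventually_gt_atTop 0] with r hr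
  have hpos : 0 < r + dist x y := by positivity
  have hsub : Metric.ball y r ⊆ Metric.ball x (r + dist x y) :=
    Metric.ball_subset_ball' (by rw [dist_comm])
  calc m.real (Metric.ball y r) ^ (1 / N) / r
      ≤ m.real (Metric.ball x (r + dist x y)) ^ (1 / N) / r := by
        have hN0 : 0 < N := by linarith
        gcongr
        exact (hCD.measure_ball_lt_top hN x _).ne
    _ = _ := by simp only [Function.comp]; field_simp

theorem CD0.exists_forall_tendsto_ball_rpow_div [Nonempty M] (hN : 1 < N) (hCD : CD0 N m) :
    ∃ l : ℝ, 0 ≤ l ∧ ∀ x : M,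
      Tendsto (fun r => m.real (Metric.ball x r) ^ (1 / N) / r) atTop (𝓝 l) := by
  obtain ⟨x₀⟩ := ‹Nonempty M›
  obtain ⟨l, hl⟩ := hCD.exists_tendsto_ball_rpow_div hN x₀
  refine ⟨l, ge_of_tendsto hl ?_, fun x => ?_⟩
  · filter_upwards [eventually_ge_atTop 0] with r hr
    positivity
  · obtain ⟨l', hl'⟩ := hCD.exists_tendsto_ball_rpow_div hN x
    rwa [le_antisymm (hCD.ball_rpow_div_limit_le hN hl' hl)
      (hCD.ball_rpow_div_limit_le hN hl hl')]

theorem CD0.tendsto_volumeRatio (hN : 1 < N) (hCD : CD0 N m) {x : M} {l : ℝ}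
    (hl : Tendsto (fun r => m.real (Metric.ball x r) ^ (1 / N) / r) atTop (𝓝 l)) :
    Tendsto (fun r => volumeRatio N m x r) atTop (𝓝 (ENNReal.ofReal (l ^ N / omega N))) := by
  have hN0 : 0 < N := by linarith
  have hω := omega_pos hN0
  have h := ENNReal.tendsto_ofReal ((hl.rpow_const (Or.inr hN0.le)).div_const (omega N))
  refine h.congr' ?_
  filter_upwards [eventually_gt_atTop 0] with r hr
  rw [volumeRatio, ← ofReal_measureReal (hCD.measure_ball_lt_top hN x r).ne,
    ← ENNReal.ofReal_div_of_pos (by positivity), Real.div_rpow (by positivity) hr.le,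
    one_div, Real.rpow_inv_rpow measureReal_nonneg hN0.ne', div_div, mul_comm]

/-- Brunn–Minkowski between `Ω` and the ball of radius `R`, with `s = ε / (R + 2 * d)`, and
Bernoulli bound the difference quotient below by the same constant for every small `ε`, so no limit
has to be computed. -/
theorem CD0.ofReal_le_minkowskiContent (hN : 1 < N) (hCD : CD0 N m) {Ω : Set M}
    (hΩ : MeasurableSet Ω) (h0 : m Ω ≠ 0) {x₀ : M} {d R : ℝ} (hd : 0 < d)
    (hΩd : Ω ⊆ Metric.ball x₀ d) (hR : 0 < R) :
    ENNReal.ofReal (N * m.real Ω ^ ((N - 1) / N) *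
      ((m.real (Metric.ball x₀ R) ^ (1 / N) - m.real Ω ^ (1 / N)) / (R + 2 * d))) ≤
      minkowskiContent m Ω := by
  have hN0 : 0 < N := by linarith
  have hΩb : Bornology.IsBounded Ω := Metric.isBounded_ball.subset hΩd
  have hΩtop := (hCD.measure_lt_top_of_isBounded hN hΩb).ne
  have hΩpos : 0 < m.real Ω := ENNReal.toReal_pos h0 hΩtop
  refine le_liminf_of_le (by isBoundedDefault) ?_
  have hD' : 0 < R + 2 * d := by positivity
  filter_upwards [Ioo_mem_nhdsGT hD'] with ε hε
  set D' := R + 2 * d with hDdef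
  set a := m.real Ω ^ (1 / N) with ha
  set b := m.real (Metric.ball x₀ R) ^ (1 / N) with hb
  have ha0 : 0 < a := by positivity
  have hb0 : 0 ≤ b := by positivity
  have hs0 : 0 < ε / D' := div_pos hε.1 hD'
  have hs1 : ε / D' < 1 := (div_lt_one hD').2 hε.2
  -- Distances are at most `R + d`; the larger denominator `R + 2 * d` in `s` yields the strict `s *
  -- (R + d) < ε`.
  have hBM := hCD.brunn_minkowski_real hN hΩ (B := Metric.ball x₀ R) (D := R + d) (L := ε)
    Metric.isOpen_ball.measurableSet hΩb Metric.isBounded_ball h0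
    (Metric.measure_ball_pos m x₀ hR).ne'
    (fun y hy z hz => by
      have h1 := Metric.mem_ball.1 (hΩd hy)
      have h2 := Metric.mem_ball'.1 hz
      linarith [dist_triangle y x₀ z]) hs0 hs1 (by
        rw [div_mul_eq_mul_div, div_lt_iff₀ hD']
        exact mul_lt_mul_of_pos_left (by linarith) hε.1)
  have hTtop := (hCD.measure_lt_top_of_isBounded hN (hΩb.thickening (δ := ε))).ne
  have hpow : ((1 - ε / D') * a + ε / D' * b) ^ N ≤ m.real (Metric.thickening ε Ω) := by
    have h := Real.rpow_le_rpow (by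
      have : 0 ≤ 1 - ε / D' := by linarith
      positivity) hBM hN0.le
    rwa [one_div, Real.rpow_inv_rpow measureReal_nonneg hN0.ne', ← one_div] at h
  have hlin := (rpow_add_le_convex_comb_rpow hN.le ha0 hb0 hs0.le hs1.le).trans hpow
  have e1 : a ^ N = m.real Ω := by
    rw [ha, one_div, Real.rpow_inv_rpow measureReal_nonneg hN0.ne']
  have e2 : a ^ (N - 1) = m.real Ω ^ ((N - 1) / N) := by
    rw [ha, ← Real.rpow_mul measureReal_nonneg]; congr 1; ring
  rw [e1, e2] at hlin
  have hsub : Ω ⊆ Metric.thickening ε Ω := Metric.self_subset_thickening hε.1 Ω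
  rw [← ofReal_measureReal (measure_ne_top_of_subset Set.sdiff_subset hTtop),
    measureReal_sdiff hsub hΩ hTtop, ← ENNReal.ofReal_div_of_pos hε.1]
  refine ENNReal.ofReal_le_ofReal ?_
  rw [le_div_iff₀ hε.1]
  calc _ = N * m.real Ω ^ ((N - 1) / N) * (ε / D' * (b - a)) := by ring
    _ ≤ _ := by linarith

/-- The isoperimetric inequality, in terms of the limit of `m(B_x(r))^{1/N} / r`. -/
theorem CD0.isoperimetric (hN : 1 < N) (hCD : CD0 N m) {x₀ : M} {l : ℝ}
    (hl : Tendsto (fun r => m.real (Metric.ball x₀ r) ^ (1 / N) / r) atTop (𝓝 l))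
    (hl0 : 0 ≤ l) {Ω : Set M} (hb : Bornology.IsBounded Ω) (hΩ : MeasurableSet Ω) :
    ENNReal.ofReal (N * l) * m Ω ^ ((N - 1) / N) ≤ minkowskiContent m Ω := by
  have hN0 : 0 < N := by linarith
  have hexp : 0 < (N - 1) / N := div_pos (by linarith) hN0
  rcases eq_or_ne (m Ω) 0 with h0 | h0
  · rw [h0, ENNReal.zero_rpow_of_pos hexp, mul_zero]
    exact zero_le
  obtain ⟨d₀, hd₀⟩ := hb.subset_ball x₀
  set d := max d₀ 1
  have hd : 0 < d := by positivity
  have hΩd : Ω ⊆ Metric.ball x₀ d := hd₀.trans (Metric.ball_subset_ball (le_max_left _ _))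
  have hinf : Tendsto (fun r : ℝ => r + 2 * d) atTop atTop :=
    tendsto_atTop_add_const_right _ _ tendsto_id
  -- This is the quotient of the finite-`R` bound, rewritten with `R / (R + 2 * d) = 1 - 2 * d / (R
  -- + 2 * d)`.
  have h1 : Tendsto (fun r : ℝ => m.real (Metric.ball x₀ r) ^ (1 / N) / r *
      (1 - 2 * d / (r + 2 * d)) - m.real Ω ^ (1 / N) / (r + 2 * d)) atTop
      (𝓝 (l * (1 - 0) - 0)) :=
    (hl.mul (tendsto_const_nhds.sub (tendsto_const_nhds.div_atTop hinf))).sub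
      (tendsto_const_nhds.div_atTop hinf)
  rw [sub_zero, sub_zero, mul_one] at h1
  have h2 := ENNReal.tendsto_ofReal (h1.const_mul (N * m.real Ω ^ ((N - 1) / N)))
  have e : ENNReal.ofReal (N * l) * m Ω ^ ((N - 1) / N) =
      ENNReal.ofReal (N * m.real Ω ^ ((N - 1) / N) * l) := by
    rw [← ofReal_measureReal (hCD.measure_lt_top_of_isBounded hN hb).ne,
      ENNReal.ofReal_rpow_of_nonneg measureReal_nonneg hexp.le,
      ← ENNReal.ofReal_mul (by positivity)]
    congr 1; ring
  rw [e]
  refine le_of_tendsto h2 ?_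
  filter_upwards [eventually_gt_atTop 0] with R hR
  refine le_trans (le_of_eq ?_) (hCD.ofReal_le_minkowskiContent hN hΩ h0 hd hΩd hR)
  congr 2
  have : 0 < R + 2 * d := by positivity
  field_simp
  ring

/-- Bishop–Gromov bounds the measure of the ball of radius `r + ε` by `v ((r + ε) / r)^N`, with
equality at `ε = 0`. The difference quotient is thus at most the slope of this function, whose
derivative at `0` is `N * v / r`. -/
theorem CD0.minkowskiContent_ball_le (hN : 1 < N) (hCD : CD0 N m) (x : M) {r : ℝ} (hr : 0 < r) :
    minkowskiContent m (Metric.ball x r) ≤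
      ENNReal.ofReal (N * m.real (Metric.ball x r) / r) := by
  have hN0 : 0 < N := by linarith
  set v := m.real (Metric.ball x r) with hv
  have hder : HasDerivAt (fun t : ℝ => v * ((r + t) / r) ^ N) (N * v / r) 0 := by
    have h1 : HasDerivAt (fun t : ℝ => (r + t) / r) (1 / r) 0 :=
      ((hasDerivAt_id (0 : ℝ)).const_add r).div_const r
    have h2 := (h1.rpow_const (p := N) (Or.inr hN.le)).const_mul v
    refine h2.congr_deriv ?_
    rw [add_zero, div_self hr.ne', Real.one_rpow]
    ring
  have htend := ENNReal.tendsto_ofReal hder.tendsto_slope_zero_right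
  rw [← htend.liminf_eq, minkowskiContent]
  refine liminf_le_liminf ?_
  filter_upwards [self_mem_nhdsWithin] with ε (hε : 0 < ε)
  have hrε : 0 < r + ε := by positivity
  have hBG := hCD.bishop_gromov hN x hr (le_add_of_nonneg_right hε.le)
  have hbig : m.real (Metric.ball x (r + ε)) ≤ v * ((r + ε) / r) ^ N := by
    rw [div_le_div_iff₀ hrε hr, ← le_div_iff₀ hr] at hBG
    have h := Real.rpow_le_rpow (by positivity) hBG hN0.le
    rwa [one_div, Real.rpow_inv_rpow measureReal_nonneg hN0.ne', mul_div_assoc,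
      Real.mul_rpow (by positivity) (by positivity),
      Real.rpow_inv_rpow measureReal_nonneg hN0.ne'] at h
  have hsub : Metric.thickening ε (Metric.ball x r) ⊆ Metric.ball x (r + ε) := by
    rw [add_comm]; exact Metric.thickening_ball x ε r
  have hfin := (hCD.measure_ball_lt_top hN x (r + ε)).ne
  calc m (Metric.thickening ε (Metric.ball x r) \ Metric.ball x r) / ENNReal.ofReal ε
      ≤ m (Metric.ball x (r + ε) \ Metric.ball x r) / ENNReal.ofReal ε := by gcongr
    _ = ENNReal.ofReal ((m.real (Metric.ball x (r + ε)) - v) / ε) := by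
        rw [← ofReal_measureReal (measure_ne_top_of_subset Set.sdiff_subset hfin),
          measureReal_sdiff (Metric.ball_subset_ball (by linarith))
            Metric.isOpen_ball.measurableSet hfin,
          ENNReal.ofReal_div_of_pos hε]
    _ ≤ _ := by
        refine ENNReal.ofReal_le_ofReal ?_
        rw [smul_eq_mul, inv_mul_eq_div]
        simp only [zero_add, add_zero, div_self hr.ne', Real.one_rpow, mul_one]
        gcongr

/-- Large balls are asymptotically optimal in the isoperimetric inequality. -/
theorem CD0.tendsto_minkowskiContent_ball (hN : 1 < N) (hCD : CD0 N m) {x₀ : M} {l : ℝ}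
    (hl : Tendsto (fun r => m.real (Metric.ball x₀ r) ^ (1 / N) / r) atTop (𝓝 l))
    (hl0 : 0 ≤ l) :
    Tendsto (fun r : ℝ => minkowskiContent m (Metric.ball x₀ r) /
      m (Metric.ball x₀ r) ^ ((N - 1) / N)) atTop (𝓝 (ENNReal.ofReal (N * l))) := by
  have hN0 : 0 < N := by linarith
  have hexp : 0 < (N - 1) / N := div_pos (by linarith) hN0
  -- Squeeze between the isoperimetric constant `N * l` and `N m(B_{x₀}(r))^{1/N} / r`.
  refine tendsto_of_tendsto_of_tendsto_of_le_of_le' tendsto_const_nhds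
    (ENNReal.tendsto_ofReal (hl.const_mul N)) ?_ ?_
  · filter_upwards [eventually_gt_atTop 0] with r hr
    have hpos := Metric.measure_ball_pos m x₀ hr
    have hfin := hCD.measure_ball_lt_top hN x₀ r
    rw [ENNReal.le_div_iff_mul_le
      (Or.inl (ENNReal.rpow_pos hpos hfin.ne).ne') (Or.inl (by finiteness))]
    exact hCD.isoperimetric hN hl hl0 Metric.isBounded_ball Metric.isOpen_ball.measurableSet
  · filter_upwards [eventually_gt_atTop 0] with r hr
    have hv := hCD.measureReal_ball_pos hN x₀ hr
    have hfin := hCD.measure_ball_lt_top hN x₀ r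
    refine ENNReal.div_le_of_le_mul ((hCD.minkowskiContent_ball_le hN x₀ hr).trans_eq ?_)
    rw [← ofReal_measureReal hfin.ne, ENNReal.ofReal_rpow_of_nonneg measureReal_nonneg hexp.le,
      ← ENNReal.ofReal_mul (by positivity)]
    congr 1
    have e : m.real (Metric.ball x₀ r) ^ (1 / N) * m.real (Metric.ball x₀ r) ^ ((N - 1) / N) =
        m.real (Metric.ball x₀ r) := by
      rw [← Real.rpow_add hv, ← add_div, add_sub_cancel, div_self hN0.ne', Real.rpow_one]
    calc _ = N * (m.real (Metric.ball x₀ r) ^ (1 / N) *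
          m.real (Metric.ball x₀ r) ^ ((N - 1) / N)) / r := by rw [e]
      _ = _ := by ring

end Isoperimetric

end MMS

/-! ### The main theorem. -/

theorem theorem1p1 {M : Type*} [MetricSpace M] [CompleteSpace M]
    [TopologicalSpace.SeparableSpace M] [MeasurableSpace M] [BorelSpace M]
    (hgeo : MMS.IsGeodesicSpace M)
    (m : Measure M) [IsLocallyFiniteMeasure m] [m.IsOpenPosMeasure]
    (N : ℝ) (hN : 1 < N) (hCD : MMS.CD0 N m) (hAVR : 0 < MMS.avr N m) :
    -- the asymptotic volume ratio is finite and is the limit of the volume ratios at any centre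
    (MMS.avr N m ≠ ∞ ∧
      ∀ x : M, Tendsto (fun r : ℝ => MMS.volumeRatio N m x r) atTop (𝓝 (MMS.avr N m))) ∧
    -- the isoperimetric inequality
    (∀ Ω : Set M, Bornology.IsBounded Ω → MeasurableSet Ω →
      MMS.isopConstant N m * m Ω ^ ((N - 1) / N) ≤ MMS.minkowskiContent m Ω) ∧
    -- sharpness: no larger constant is admissible on this space
    (∀ C : ℝ≥0∞, MMS.isopConstant N m < C →
      ∃ Ω : Set M, Bornology.IsBounded Ω ∧ MeasurableSet Ω ∧ 0 < m Ω ∧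
        MMS.minkowskiContent m Ω < C * m Ω ^ ((N - 1) / N)) ∧
    -- and large balls are asymptotically optimal
    (∀ x₀ : M, Tendsto
      (fun r : ℝ => MMS.minkowskiContent m (Metric.ball x₀ r) /
        m (Metric.ball x₀ r) ^ ((N - 1) / N)) atTop (𝓝 (MMS.isopConstant N m))) := by
  -- On an empty space the supremum defining `avr` is over no centres and equals `0`.
  have hne : Nonempty M := by
    by_contra h
    rw [not_nonempty_iff] at h
    simp [MMS.avr] at hAVR
  obtain ⟨l, hl0, hl⟩ := hCD.exists_forall_tendsto_ball_rpow_div hN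
  have hratio := fun x => hCD.tendsto_volumeRatio hN (hl x)
  have havr : MMS.avr N m = ENNReal.ofReal (l ^ N / MMS.omega N) :=
    MMS.avr_eq_of_forall_tendsto hratio
  rw [MMS.isopConstant_eq hN hl0 havr, havr]
  have hball := fun x₀ => hCD.tendsto_minkowskiContent_ball hN (hl x₀) hl0
  obtain ⟨x₀⟩ := hne
  refine ⟨⟨by simp, hratio⟩, fun Ω hb hΩ => hCD.isoperimetric hN (hl x₀) hl0 hb hΩ, ?_, hball⟩
  intro C hC
  -- A sufficiently large ball is the witness, since the quotients of balls converge to a value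
  -- below `C`.
  obtain ⟨r, hrC, hr⟩ :=
    (((hball x₀).eventually_lt_const hC).and (eventually_gt_atTop 0)).exists
  have hpos := Metric.measure_ball_pos m x₀ hr
  have hfin := hCD.measure_ball_lt_top hN x₀ r
  have hexp : 0 < (N - 1) / N := div_pos (by linarith) (by linarith)
  refine ⟨Metric.ball x₀ r, Metric.isBounded_ball, Metric.isOpen_ball.measurableSet, hpos, ?_⟩
  exact (ENNReal.div_lt_iff (Or.inl (ENNReal.rpow_pos hpos hfin.ne).ne')
    (Or.inl (by finiteness))).1 hrC
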